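/- Let $\mathbb{R}_{\ge}=[0,\infty)$ and $[m]=\{1,\dots,m\}$. An $n$-resource/$k$-player-type \emph{resource selection game with I.D.-dependent weighting} $G$ consists of a nondecreasing cost function $f_j:\mathbb{R}_{\ge}\to\mathbb{R}$ for each resource $j\in[n]$, a nonempty set $R^i\subseteq[n]$ of legal resources for each player type $i\in[k]$, and a nondecreasing weighting function $f^i_j:[0,1]\to\mathbb{R}_{\ge}$ for each $i\in[k]$ and $j\in R^i$ (no continuity is assumed). A \emph{consumption profile} $s$ assigns to each $i\in[k]$ a vector $s(i)=(s_j(i))_{j\in[n]}\in[0,1]^n$ with $\sum_{j\in R^i}s_j(i)=1$ and $s_j(i)=0$ for $j\notin R^i$. The cost of resource $j$ under $s$ is $h_j(s)=f_j\bigl(\sum_{i:\,j\in R^i}f^i_j(s_j(i))\bigr)$. A profile $s$ is a \emph{Nash equilibrium} if $h_\ell(s)\le h_j(s)$ for all $i\in[k]$, all $\ell$ with $s_\ell(i)>0$ and all $j\in R^i$; in this case let $h^i(s)$ be the common value of $h_j(s)$ over all $j$ with $s_j(i)>0$. A Nash equilibrium $s$ is \emph{strong} if there is no profile $s'\neq s$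 such that $h_\ell(s')<h^i(s)$ for all $i\in[k]$ and $\ell\in[n]$ with $s'_\ell(i)>s_\ell(i)$. \textbf{Theorem (Uniqueness of Strong Equilibrium Resource Costs).} (1) There are a resource selection game with I.D.-dependent weighting, all of whose weighting functions are strictly increasing, two Nash equilibria $s,s'$ in it, and a resource $j$ such that $h_j(s)\neq h_j(s')$. (2) In every resource selection game with I.D.-dependent weighting, $h_j(s)=h_j(s')$ for every resource $j\in[n]$ and every two strong Nash equilibria $s,s'$. -/

import Mathlib

open scoped NNReal

/-- The simplex `Δ^R`: vectors in `[0,1]^n` whose coordinates in `R` add up to `1` and whose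
coordinates outside `R` vanish. -/
def simplexOn {n : ℕ} (R : Finset (Fin n)) : Set (Fin n → ℝ) :=
  {x | (∀ j, x j ∈ Set.Icc (0 : ℝ) 1) ∧ ∑ j ∈ R, x j = 1 ∧ ∀ j, j ∉ R → x j = 0}

/-- A resource selection game with I.D.-dependent weighting, with `n` resources and `k` player
types. The monotonicity of the weighting functions is the weak one. -/
structure IDGame (n k : ℕ) where
  /-- the cost function `f_j` of resource `j` -/
  cost : Fin n → ℝ≥0 → ℝ
  cost_mono : ∀ j, Monotone (cost j)
  /-- the set `R^i` of legal resources of player type `i` -/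
  legal : Fin k → Finset (Fin n)
  legal_nonempty : ∀ i, (legal i).Nonempty
  /-- the weighting function `f^i_j : [0,1] → [0,∞)` of type `i` on its legal resource `j` -/
  weight : (i : Fin k) → {j : Fin n // j ∈ legal i} → Set.Icc (0 : ℝ) 1 → ℝ≥0
  weight_mono : ∀ i j, Monotone (weight i j)

namespace IDGame

variable {n k : ℕ}

/-- A consumption (strategy) profile: `s.1 i j` is the fraction of the players of type `i` who
consume from resource `j`. -/
abbrev Profile (G : IDGame n k) : Type :=
  {s : Fin k → Fin n → ℝ // ∀ i, s i ∈ simplexOn (G.legal i)}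

/-- The weighted load on resource `j`: the sum of `f^i_j (s_j(i))` over the types `i` for which
`j` is legal. -/
noncomputable def load (G : IDGame n k) (s : G.Profile) (j : Fin n) : ℝ≥0 :=
  ∑ i, if h : j ∈ G.legal i then G.weight i ⟨j, h⟩ ⟨s.1 i j, (s.2 i).1 j⟩ else 0

/-- The cost `h_j(s)` of resource `j` under the profile `s`. -/
noncomputable def height (G : IDGame n k) (s : G.Profile) (j : Fin n) : ℝ :=
  G.cost j (G.load s j)

/-- Every resource used by a type is a cheapest legal resource for this type. -/
def IsNash (G : IDGame n k) (s : G.Profile) : Prop :=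
  ∀ i, ∀ l, 0 < s.1 i l → ∀ j ∈ G.legal i, G.height s l ≤ G.height s j

/-- A Nash equilibrium `s` is strong if there is no profile `s' ≠ s` such that, whenever
more players of type `i` consume from `l` in `s'` than in `s`, the cost of `l` in `s'` is lower
than the cost paid by type `i` in `s`. The latter cost is that of any resource `j` used by type
`i` in `s`: such `j` exists, and all of them cost the same. -/
def IsStrongNash (G : IDGame n k) (s : G.Profile) : Prop :=
  G.IsNash s ∧
    ¬ ∃ s' : G.Profile, s' ≠ s ∧
      ∀ i l, 0 < s'.1 i l → s.1 i l < s'.1 i l →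
        ∀ j, 0 < s.1 i j → G.height s' l < G.height s j

end IDGame

namespace IDGame

variable {n k : ℕ}

/-! Let `s` be strong and `s'` Nash, and suppose resource `j` is cheaper in `s'`. By monotonicity
some type uses `j` in `s`, and that type improves in `s'`. Let exactly the improving types switch to
`s'`. On a resource they then use, no other type was present in `s`, since it would improve too; so
the cost is at most that in `s'` (`Improves.height_deviation_le`). The switch thus benefits every
mover, against strongness. Hence `s` is cheapest on every resource among Nash equilibria, and two
strong equilibria agree by antisymmetry. For (1), two types can settle on their light resources or
both on their heavy ones. -/

/-- Every type uses one of its legal resources. -/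
lemma exists_pos (G : IDGame n k) (s : G.Profile) (i : Fin k) :
    ∃ j ∈ G.legal i, 0 < s.1 i j := by
  by_contra! h
  have h1 := (s.2 i).2.1
  have h2 : ∑ j ∈ G.legal i, s.1 i j ≤ 0 := Finset.sum_nonpos h
  linarith

lemma mem_legal_of_pos (G : IDGame n k) (s : G.Profile) {i : Fin k} {j : Fin n}
    (h : 0 < s.1 i j) : j ∈ G.legal i := by
  by_contra hj
  exact h.ne' ((s.2 i).2.2 j hj)

/-- The cost of a resource is monotone in the consumption from it. -/
lemma height_le (G : IDGame n k) (s t : G.Profile) (j : Fin n)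
    (h : ∀ i, s.1 i j ≤ t.1 i j) : G.height s j ≤ G.height t j := by
  refine G.cost_mono j (Finset.sum_le_sum fun i _ => ?_)
  split_ifs with hj
  · exact G.weight_mono i ⟨j, hj⟩ (h i)
  · exact le_rfl

/-- Type `i` finds in `s'` a legal resource that is cheaper than all its legal resources in `s`. -/
def Improves (G : IDGame n k) (s s' : G.Profile) (i : Fin k) : Prop :=
  ∃ l, 0 < s'.1 i l ∧ ∀ j ∈ G.legal i, G.height s' l < G.height s j

open Classical in
/-- The profile obtained from `s` when the types that improve in `s'` move to their
strategies in `s'`. -/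
noncomputable def deviation (G : IDGame n k) (s s' : G.Profile) : G.Profile :=
  ⟨fun i => if G.Improves s s' i then s'.1 i else s.1 i, fun i => by
    dsimp only
    split_ifs
    exacts [s'.2 i, s.2 i]⟩

lemma deviation_of_improves (G : IDGame n k) {s s' : G.Profile} {i : Fin k}
    (h : G.Improves s s' i) : (G.deviation s s').1 i = s'.1 i :=
  if_pos h

lemma deviation_of_not_improves (G : IDGame n k) {s s' : G.Profile} {i : Fin k}
    (h : ¬ G.Improves s s' i) : (G.deviation s s').1 i = s.1 i :=
  if_neg h

/-- If a type uses in `s` a resource that is cheaper in `s'`, then this type improves. -/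
lemma improves_of_height_lt (G : IDGame n k) {s s' : G.Profile} (hs : G.IsNash s)
    (hs' : G.IsNash s') {i : Fin k} {l : Fin n} (hl : 0 < s.1 i l)
    (h : G.height s' l < G.height s l) : G.Improves s s' i := by
  obtain ⟨m, -, hm⟩ := G.exists_pos s' i
  refine ⟨m, hm, fun j hj => ?_⟩
  exact (hs' i m hm l (G.mem_legal_of_pos s hl)).trans_lt (h.trans_le (hs i l hl j hj))

/-- All resources used by a type in a Nash equilibrium cost the same, so any of them can serve as
the witness of improvement. -/
lemma Improves.height_lt {G : IDGame n k} {s s' : G.Profile} (hs' : G.IsNash s') {i : Fin k}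
    (hi : G.Improves s s' i) {l j : Fin n} (hl : 0 < s'.1 i l) (hj : j ∈ G.legal i) :
    G.height s' l < G.height s j := by
  obtain ⟨m, hm, h⟩ := hi
  exact (hs' i l hl m (G.mem_legal_of_pos s' hm)).trans_lt (h j hj)

/-- The resources that an improving type uses in `s'` cost no more after the deviation than
in `s'`. -/
lemma Improves.height_deviation_le {G : IDGame n k} {s s' : G.Profile} (hs : G.IsNash s)
    (hs' : G.IsNash s') {i : Fin k} (hi : G.Improves s s' i) {l : Fin n} (hl : 0 < s'.1 i l) :
    G.height (G.deviation s s') l ≤ G.height s' l := by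
  refine G.height_le _ _ _ fun i' => ?_
  by_cases h' : G.Improves s s' i'
  · rw [G.deviation_of_improves h']
  · rw [G.deviation_of_not_improves h']
    -- A type that does not improve cannot use `l` in `s`, so it contributes zero consumption there.
    refine le_trans (not_lt.1 fun hpos => h' ?_) ((s'.2 i').1 l).1
    exact G.improves_of_height_lt hs hs' hpos (hi.height_lt hs' hl (G.mem_legal_of_pos s' hl))

/-- No type improves upon a strong Nash equilibrium in another Nash equilibrium. -/
lemma IsStrongNash.not_improves {G : IDGame n k} {s s' : G.Profile} (hs : G.IsStrongNash s)
    (hs' : G.IsNash s') (i : Fin k) : ¬ G.Improves s s' i := by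
  intro hi
  refine hs.2 ⟨G.deviation s s', fun heq => ?_, fun i' l hl hlt j hj => ?_⟩
  -- Were the deviation equal to `s`, a resource used by `i` in `s'` would be no dearer in `s` than
  -- in `s'`.
  · obtain ⟨l, hl', hl⟩ := G.exists_pos s' i
    have h := hi.height_deviation_le hs.1 hs' hl
    rw [heq] at h
    exact h.not_gt (hi.height_lt hs' hl hl')
  · by_cases h' : G.Improves s s' i'
    · rw [G.deviation_of_improves h'] at hl
      exact (h'.height_deviation_le hs.1 hs' hl).trans_lt
        (h'.height_lt hs' hl (G.mem_legal_of_pos s hj))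
    · rw [G.deviation_of_not_improves h'] at hlt
      exact absurd hlt (lt_irrefl _)

/-- No resource is cheaper in a Nash equilibrium than in a strong Nash equilibrium. -/
lemma IsStrongNash.height_le {G : IDGame n k} {s s' : G.Profile} (hs : G.IsStrongNash s)
    (hs' : G.IsNash s') (j : Fin n) : G.height s j ≤ G.height s' j := by
  by_contra! h
  refine h.not_ge (G.height_le _ _ _ fun i => ?_)
  -- No type uses `j` in `s`, since it would improve.
  refine le_trans (not_lt.1 fun hpos => ?_) ((s'.2 i).1 j).1
  exact hs.not_improves hs' i (G.improves_of_height_lt hs.1 hs' hpos h)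

/-- Two types and two resources: consumption of a type weighs twice as much on the resource
with the other index. -/
noncomputable def crossGame : IDGame 2 2 where
  cost _ x := x
  cost_mono _ _ _ h := NNReal.coe_le_coe.2 h
  legal _ := Finset.univ
  legal_nonempty _ := Finset.univ_nonempty
  weight i j x := (if i = j.1 then 1 else 2) * ⟨x.1, x.2.1⟩
  weight_mono _ _ _ _ h := mul_le_mul_right (α := ℝ≥0) h _

lemma crossGame_weight_strictMono (i : Fin 2) (j : {j : Fin 2 // j ∈ crossGame.legal i}) :
    StrictMono (crossGame.weight i j) := by
  intro x y h
  refine mul_lt_mul_of_pos_left (show (⟨x.1, x.2.1⟩ : ℝ≥0) < ⟨y.1, y.2.1⟩ from h) ?_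
  split_ifs <;> norm_num

/-- Type `i` consumes from resource `σ i` only. -/
noncomputable def crossProfile (σ : Equiv.Perm (Fin 2)) : crossGame.Profile :=
  ⟨fun i j => if σ i = j then 1 else 0, fun i =>
    ⟨fun j => by dsimp only; split_ifs <;> simp, by simp [crossGame], fun j hj => by simp [crossGame] at hj⟩⟩

lemma crossGame_height_one (j : Fin 2) : crossGame.height (crossProfile 1) j = 1 := by
  fin_cases j <;> simp [height, load, crossGame, crossProfile, Fin.sum_univ_two]
  · change (1 : ℝ) * 1 + 2 * 0 = 1
    norm_num
  · change (2 : ℝ) * 0 + 1 * 1 = 1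
    norm_num

lemma crossGame_height_swap (j : Fin 2) :
    crossGame.height (crossProfile (Equiv.swap 0 1)) j = 2 := by
  fin_cases j <;> simp [height, load, crossGame, crossProfile, Fin.sum_univ_two]
  · change (1 : ℝ) * 0 + 2 * 1 = 2
    norm_num
  · change (2 : ℝ) * 1 + 1 * 0 = 2
    norm_num

end IDGame

theorem mainTheorem6 :
    (∃ (n k : ℕ) (G : IDGame n k), (∀ i j, StrictMono (G.weight i j)) ∧
      ∃ s s' : G.Profile, G.IsNash s ∧ G.IsNash s' ∧ ∃ j, G.height s j ≠ G.height s' j) ∧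
    (∀ (n k : ℕ) (G : IDGame n k) (s s' : G.Profile),
      G.IsStrongNash s → G.IsStrongNash s' → ∀ j, G.height s j = G.height s' j) := by
  -- In each of the two profiles both resources cost the same, so the Nash condition is immediate.
  refine ⟨⟨2, 2, IDGame.crossGame, IDGame.crossGame_weight_strictMono, IDGame.crossProfile 1,
    IDGame.crossProfile (Equiv.swap 0 1), fun i l _ j _ => ?_, fun i l _ j _ => ?_, 0, ?_⟩,
    fun n k G s s' hs hs' j => le_antisymm (hs.height_le hs'.1 j) (hs'.height_le hs.1 j)⟩
  · simp only [IDGame.crossGame_height_one, le_refl]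
  · simp only [IDGame.crossGame_height_swap, le_refl]
  · rw [IDGame.crossGame_height_one, IDGame.crossGame_height_swap]
    norm_num
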